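/- Let $a>0$, $b<0$ be real and let $\alpha$ be real with $\alpha^2=b^2/16$. Put $T=-a/b>0$. Write $z=\frac{x_1+ix_2}{2}$, $\partial_z=\partial_{x_1}-i\partial_{x_2}$, $\partial_{\bar z}=\partial_{x_1}+i\partial_{x_2}$ (so $\partial_z\partial_{\bar z}=\Delta$), let $\mathbf H^2=\{s\in\mathbf R^3: s_1^2+s_2^2-s_3^2=-1,\ s_3<0\}$, and identify $s\in\mathbf H^2$ with the matrix $S=\begin{pmatrix} is_3 & s_1+is_2\\ s_1-is_2 & -is_3\end{pmatrix}\in su(1,1)$. Then there is a $C^\infty$ map $S:(-\infty,T)\times\mathbf R^2\to\mathbf H^2$ which solves the Schr\"odinger map equation $$S_t=-\tfrac12[S,S_{z\bar z}]\qquad\text{on }(-\infty,T)\times\mathbf R^2$$ and whose gradient $|\nabla S|=\sum_{j=1}^3\big(|(s_j)_z|+|(s_j)_{\bar z}|\big)$ tends to $+\infty$ as $t\uparrow T=-a/b$ at every point of the plane except the origin, and does not tend to $+\infty$ at the origin. Moreover $S=-iG\sigma_3G^{-1}$, with $\sigma_3=\mathrm{diag}(1,-1)$, for a $C^\infty$ map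 $G:(-\infty,T)\times\mathbf R^2\to SU(1,1)$ satisfying $$G_z=-G\begin{pmatrix}0&q\\ r&0\end{pmatrix},\qquad G_{\bar z}=G\begin{pmatrix}0&-\bar r\\ -\bar q&0\end{pmatrix},\qquad G_t=iG\begin{pmatrix}u&-q_{\bar z}\\ r_{\bar z}&-u\end{pmatrix},$$ where $$q=\frac{e^{\frac{ibz\bar z}{2(a+bt)}}}{a+bt}\,\alpha\bar z,\qquad r=\frac{e^{-\frac{ibz\bar z}{2(a+bt)}}}{a+bt}\,\alpha\bar z,\qquad u=\frac{2\alpha^2z\bar z}{(a+bt)^2},$$ and $|q|+|r|\le|\nabla S|$ holds on $(-\infty,T)\times\mathbf R^2$. -/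

import Mathlib

open Filter Topology Set
open scoped ContDiff

noncomputable section

/-- The sheet `s₃ < 0` of the hyperboloid `s₁² + s₂² - s₃² = -1` in Minkowski 3-space; a model of
the hyperbolic plane. -/
def hyperbolicPlane : Set (Fin 3 → ℝ) :=
  {s | s 0 ^ 2 + s 1 ^ 2 - s 2 ^ 2 = -1 ∧ s 2 < 0}

/-- `∂/∂z = ∂/∂x₁ - i ∂/∂x₂`, for the complex coordinate `z = (x₁ + i x₂) / 2`. -/
def dz (f : ℝ → ℝ → ℂ) (x y : ℝ) : ℂ :=
  deriv (fun x' => f x' y) x - Complex.I * deriv (fun y' => f x y') y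

/-- `∂/∂z̄ = ∂/∂x₁ + i ∂/∂x₂`, for the complex coordinate `z = (x₁ + i x₂) / 2`. -/
def dzbar (f : ℝ → ℝ → ℂ) (x y : ℝ) : ℂ :=
  deriv (fun x' => f x' y) x + Complex.I * deriv (fun y' => f x y') y

/-- Entrywise `∂/∂z` of a matrix valued function. -/
def matDz (F : ℝ → ℝ → Matrix (Fin 2) (Fin 2) ℂ) (x y : ℝ) : Matrix (Fin 2) (Fin 2) ℂ :=
  Matrix.of fun j k => dz (fun x' y' => F x' y' j k) x y

/-- Entrywise `∂/∂z̄` of a matrix valued function. -/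
def matDzbar (F : ℝ → ℝ → Matrix (Fin 2) (Fin 2) ℂ) (x y : ℝ) : Matrix (Fin 2) (Fin 2) ℂ :=
  Matrix.of fun j k => dzbar (fun x' y' => F x' y' j k) x y

/-- Entrywise `∂/∂t` of a matrix valued function. -/
def matDt (F : ℝ → ℝ → ℝ → Matrix (Fin 2) (Fin 2) ℂ) (t x y : ℝ) : Matrix (Fin 2) (Fin 2) ℂ :=
  Matrix.of fun j k => deriv (fun t' => F t' x y j k) t

/-- The matrix in `su(1,1)` of a vector `(s₁, s₂, s₃)`. -/
def spinMatrix (s : Fin 3 → ℝ) : Matrix (Fin 2) (Fin 2) ℂ :=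
  !![Complex.I * (s 2 : ℂ), (s 0 : ℂ) + Complex.I * (s 1 : ℂ);
     (s 0 : ℂ) - Complex.I * (s 1 : ℂ), -(Complex.I * (s 2 : ℂ))]

/-- `s = s(t, x₁, x₂)` is a `C^∞` Schrödinger map from the plane to the hyperbolic plane for times
in the open set `J`: it is smooth on `J × ℝ²`, takes values in the hyperboloid, and its matrix
`S` satisfies `S_t = -½ [S, S_{z z̄}]`. -/
structure IsSmoothSchrodingerMap (J : Set ℝ) (s : ℝ → ℝ → ℝ → Fin 3 → ℝ) : Prop where
  smooth : ContDiffOn ℝ ∞ (fun w : ℝ × ℝ × ℝ => s w.1 w.2.1 w.2.2) (J ×ˢ univ)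
  mem : ∀ t ∈ J, ∀ x y : ℝ, s t x y ∈ hyperbolicPlane
  eqn : ∀ t ∈ J, ∀ x y : ℝ,
    matDt (fun t' x' y' => spinMatrix (s t' x' y')) t x y =
      -(1 / 2 : ℂ) •
        (spinMatrix (s t x y) *
            matDz (matDzbar fun x' y' => spinMatrix (s t x' y')) x y -
          matDz (matDzbar fun x' y' => spinMatrix (s t x' y')) x y *
            spinMatrix (s t x y))

/-- The length of the spatial gradient at a point,
`|∇S| = ∑ⱼ (|(sⱼ)_z| + |(sⱼ)_z̄|)`. -/
def gradSize (s : ℝ → ℝ → Fin 3 → ℝ) (x y : ℝ) : ℝ :=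
  ∑ j : Fin 3, (‖dz (fun x' y' => (s x' y' j : ℂ)) x y‖ +
    ‖dzbar (fun x' y' => (s x' y' j : ℂ)) x y‖)

/-- The Pauli matrix `σ₃`. -/
def sigma3 : Matrix (Fin 2) (Fin 2) ℂ := !![1, 0; 0, -1]

/-- The group `SU(1,1)`. -/
def SU11 : Set (Matrix (Fin 2) (Fin 2) ℂ) :=
  {G | G.conjTranspose * sigma3 * G = sigma3 ∧ G.det = 1}

/-- `G` is a smooth `SU(1,1)`-valued gauge which transforms `(p, q, r, u)` into `s` on `J × ℝ²`:
it solves the linear system with coefficients `(p, q, r, u)`, and `S = -i G σ₃ G⁻¹`. -/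
structure IsGaugeTransform (J : Set ℝ) (p q r : ℝ → ℝ → ℝ → ℂ) (u : ℝ → ℝ → ℝ → ℝ)
    (G : ℝ → ℝ → ℝ → Matrix (Fin 2) (Fin 2) ℂ) (s : ℝ → ℝ → ℝ → Fin 3 → ℝ) : Prop where
  smooth : ∀ j k : Fin 2,
    ContDiffOn ℝ ∞ (fun w : ℝ × ℝ × ℝ => G w.1 w.2.1 w.2.2 j k) (J ×ˢ univ)
  mem : ∀ t ∈ J, ∀ x y : ℝ, G t x y ∈ SU11
  eqn_z : ∀ t ∈ J, ∀ x y : ℝ,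
    matDz (G t) x y = -(G t x y * !![p t x y, q t x y; r t x y, -p t x y])
  eqn_zbar : ∀ t ∈ J, ∀ x y : ℝ,
    matDzbar (G t) x y = G t x y *
      !![star (p t x y), -star (r t x y); -star (q t x y), -star (p t x y)]
  eqn_t : ∀ t ∈ J, ∀ x y : ℝ,
    matDt G t x y = G t x y *
      !![Complex.I * (u t x y : ℂ),
          -(Complex.I * (dzbar (q t) x y + 2 * star (p t x y) * q t x y));
        Complex.I * (dzbar (r t) x y - 2 * star (p t x y) * r t x y),
          -(Complex.I * (u t x y : ℂ))]
  spin_eq : ∀ t ∈ J, ∀ x y : ℝ,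
    spinMatrix (s t x y) = -(Complex.I • (G t x y * sigma3 * (G t x y)⁻¹))

/-- The complex coordinate `z = (x₁ + i x₂) / 2`. -/
def zc (x y : ℝ) : ℂ := ((x : ℂ) + Complex.I * (y : ℂ)) / 2

/-- `q = exp(i b z z̄ / (2(a+bt))) α z̄ / (a+bt)`. -/
def qExplicit (a b α t x y : ℝ) : ℂ :=
  Complex.exp (Complex.I * (b * zc x y * star (zc x y) / (2 * (a + b * t)))) / (a + b * t) *
    α * star (zc x y)

/-- `r = exp(-i b z z̄ / (2(a+bt))) α z̄ / (a+bt)`. -/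
def rExplicit (a b α t x y : ℝ) : ℂ :=
  Complex.exp (-(Complex.I * (b * zc x y * star (zc x y) / (2 * (a + b * t))))) / (a + b * t) *
    α * star (zc x y)

/-- `u = 2 α² z z̄ / (a+bt)²`. -/
def uExplicit (a b α t x y : ℝ) : ℝ :=
  2 * α ^ 2 * ‖zc x y‖ ^ 2 / (a + b * t) ^ 2

end

/-! Put m = (a + bt)^(1/4), ρ = z z̄, κ = b/(4m⁴), E = exp(iκρ) and α = εb/4, so that ε² = 1. Then q
= εκE² z̄ and r = εκE⁻² z̄. Since q/z̄ and r/z̄ are conjugate radial functions, for a radial gauge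
with rows (P, Q) and (Q̄, P̄) the z- and z̄-equations are one and the same linear ODE in ρ.
Substituting P = A E⁻¹, Q = B E gives A' = κ(iA - εB), B' = -κ(εA + iB). The matrix of this system
has square κ²(ε² - 1) = 0: the condition on α is nilpotency, and A, B are affine in ρ. At ρ = 0,
because m_t/m = κ, the time equation is solved by P = cosh(log m), Q = -iε sinh(log m). These data
determine `gaugeP` and `gaugeQ`.

The diagonal phases commute with σ₃, so E drops out of S = -iGσ₃G⁻¹ and leaves the rational map
`blowupSpin`; at each time its image lies on a horocycle, where εs₁ + s₃ = -m⁻². That it is a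
Schrödinger map is checked directly in `schrodinger_identity`, not deduced from the gauge system.

The coordinate s₂ = -εbρ/(2m⁴) is linear in ρ, so |∂_z s₂| = |b||z|/(2(a + bt)). This is exactly |q|
+ |r|, and it diverges as t ↑ T unless z = 0. At the origin ∇ρ = 0, so the gradient vanishes for all
t < T. -/

noncomputable section

/-! ### Wirtinger calculus for radial functions -/

/-- `z z̄` for the complex coordinate `z = (x₁ + i x₂) / 2`. -/
def radSq (x y : ℝ) : ℝ := (x ^ 2 + y ^ 2) / 4

lemma zc_mul_star (x y : ℝ) : zc x y * star (zc x y) = (radSq x y : ℂ) := by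
  simp only [zc, radSq, Complex.star_def, map_div₀, map_add, map_mul, Complex.conj_ofReal,
    Complex.conj_I, map_ofNat]
  push_cast
  linear_combination (-(y : ℂ) ^ 2 / 4) * Complex.I_sq

lemma star_zc (x y : ℝ) : star (zc x y) = ((x : ℂ) - Complex.I * y) / 2 := by
  simp only [zc, Complex.star_def, map_div₀, map_add, map_mul, Complex.conj_ofReal,
    Complex.conj_I, map_ofNat]
  ring

lemma norm_zc_sq (x y : ℝ) : ‖zc x y‖ ^ 2 = radSq x y := by
  have h := zc_mul_star x y
  rw [Complex.star_def, Complex.mul_conj, Complex.normSq_eq_norm_sq] at h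
  exact_mod_cast h

lemma hasDerivAt_radSq_left (x y : ℝ) : HasDerivAt (fun x' => radSq x' y) (x / 2) x := by
  have h := (((hasDerivAt_id x).fun_pow 2).add_const (y ^ 2)).div_const 4
  refine h.congr_deriv ?_
  simp
  ring

lemma hasDerivAt_radSq_right (x y : ℝ) : HasDerivAt (fun y' => radSq x y') (y / 2) y := by
  have h := (((hasDerivAt_id y).fun_pow 2).const_add (x ^ 2)).div_const 4
  refine h.congr_deriv ?_
  simp
  ring

section radial

variable {F : ℝ → ℂ} {F' : ℂ} {x y : ℝ}

lemma hasDerivAt_radial_left (h : HasDerivAt F F' (radSq x y)) :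
    HasDerivAt (fun x' => F (radSq x' y)) ((x / 2 : ℂ) * F') x := by
  refine (h.scomp x (hasDerivAt_radSq_left x y)).congr_deriv ?_
  simp

lemma hasDerivAt_radial_right (h : HasDerivAt F F' (radSq x y)) :
    HasDerivAt (fun y' => F (radSq x y')) ((y / 2 : ℂ) * F') y := by
  refine (h.scomp y (hasDerivAt_radSq_right x y)).congr_deriv ?_
  simp

/-- The normalisation z = (x₁ + i x₂)/2 makes ∂_z z = 1 and ∂_z z̄ = 0, hence ∂_z ρ = z̄. -/
lemma dz_radial (h : HasDerivAt F F' (radSq x y)) :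
    dz (fun x' y' => F (radSq x' y')) x y = F' * star (zc x y) := by
  rw [dz, (hasDerivAt_radial_left h).deriv, (hasDerivAt_radial_right h).deriv, star_zc]
  ring

lemma dzbar_radial (h : HasDerivAt F F' (radSq x y)) :
    dzbar (fun x' y' => F (radSq x' y')) x y = F' * zc x y := by
  rw [dzbar, (hasDerivAt_radial_left h).deriv, (hasDerivAt_radial_right h).deriv, zc]
  ring

lemma hasDerivAt_zc_left (x y : ℝ) : HasDerivAt (fun x' => zc x' y) (1 / 2) x := by
  simpa [zc] using ((hasDerivAt_id x).ofReal_comp.add_const (Complex.I * y)).div_const 2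

lemma hasDerivAt_zc_right (x y : ℝ) : HasDerivAt (fun y' => zc x y') (Complex.I / 2) y := by
  simpa [zc] using
    (((hasDerivAt_id y).ofReal_comp.const_mul Complex.I).const_add (x : ℂ)).div_const 2

/-- Product rule with ∂_z z = 1. For F = f' it yields the radial Laplacian ρf'' + f'. -/
lemma dz_radial_mul_zc (h : HasDerivAt F F' (radSq x y)) :
    dz (fun x' y' => F (radSq x' y') * zc x' y') x y = radSq x y * F' + F (radSq x y) := by
  rw [dz, ((hasDerivAt_radial_left h).fun_mul (hasDerivAt_zc_left x y)).deriv,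
    ((hasDerivAt_radial_right h).fun_mul (hasDerivAt_zc_right x y)).deriv, ← zc_mul_star, star_zc]
  linear_combination (-F (radSq x y) / 2) * Complex.I_sq

lemma dzbar_radial_mul_star_zc (h : HasDerivAt F F' (radSq x y)) :
    dzbar (fun x' y' => F (radSq x' y') * star (zc x' y')) x y =
      radSq x y * F' + F (radSq x y) := by
  rw [dzbar, ((hasDerivAt_radial_left h).fun_mul (hasDerivAt_zc_left x y).star).deriv,
    ((hasDerivAt_radial_right h).fun_mul (hasDerivAt_zc_right x y).star).deriv, ← zc_mul_star]
  simp only [Complex.star_def, map_div₀, map_one, Complex.conj_I, map_ofNat]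
  rw [zc]
  linear_combination (-F (radSq x y) / 2) * Complex.I_sq

end radial

/-- Transfers the equations for the first row of the gauge to its conjugate second row. -/
lemma dz_star (f : ℝ → ℝ → ℂ) (x y : ℝ) :
    dz (fun x' y' => star (f x' y')) x y = star (dzbar f x y) := by
  have h1 : deriv (fun x' => star (f x' y)) x = star (deriv (fun x' => f x' y) x) := deriv.star
  have h2 : deriv (fun y' => star (f x y')) y = star (deriv (fun y' => f x y') y) := deriv.star
  rw [dz, dzbar, h1, h2, star_add, star_mul']
  simp only [Complex.star_def, Complex.conj_I]
  ring

lemma dzbar_star (f : ℝ → ℝ → ℂ) (x y : ℝ) :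
    dzbar (fun x' y' => star (f x' y')) x y = star (dz f x y) := by
  have h1 : deriv (fun x' => star (f x' y)) x = star (deriv (fun x' => f x' y) x) := deriv.star
  have h2 : deriv (fun y' => star (f x y')) y = star (deriv (fun y' => f x y') y) := deriv.star
  rw [dz, dzbar, h1, h2, star_sub, star_mul']
  simp only [Complex.star_def, Complex.conj_I]
  ring

/-! ### Derivatives of radial spin matrices -/

lemma hasDerivAt_spinMatrix {f : ℝ → Fin 3 → ℝ} {f' : Fin 3 → ℝ} {x : ℝ}
    (h : ∀ j, HasDerivAt (fun x' => f x' j) (f' j) x) (j k : Fin 2) :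
    HasDerivAt (fun x' => spinMatrix (f x') j k) (spinMatrix f' j k) x := by
  have h0 := (h 0).ofReal_comp
  have h1 := (h 1).ofReal_comp.const_mul Complex.I
  have h2 := (h 2).ofReal_comp.const_mul Complex.I
  fin_cases j <;> fin_cases k
  · exact h2
  · exact h0.add h1
  · exact h0.sub h1
  · exact h2.fun_neg

lemma matDzbar_spinMatrix_radial {f : ℝ → Fin 3 → ℝ} {f' : Fin 3 → ℝ} {x y : ℝ}
    (h : ∀ j, HasDerivAt (fun ρ => f ρ j) (f' j) (radSq x y)) :
    matDzbar (fun x' y' => spinMatrix (f (radSq x' y'))) x y =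
      Matrix.of fun j k => spinMatrix f' j k * zc x y := by
  ext j k
  exact dzbar_radial (hasDerivAt_spinMatrix h j k)

lemma matDz_matDzbar_spinMatrix_radial {f f' : ℝ → Fin 3 → ℝ} {f'' : Fin 3 → ℝ} {x y : ℝ}
    (h : ∀ ρ j, HasDerivAt (fun ρ' => f ρ' j) (f' ρ j) ρ)
    (h' : ∀ j, HasDerivAt (fun ρ => f' ρ j) (f'' j) (radSq x y)) :
    matDz (matDzbar fun x' y' => spinMatrix (f (radSq x' y'))) x y =
      spinMatrix fun j => radSq x y * f'' j + f' (radSq x y) j := by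
  have e : matDzbar (fun x' y' => spinMatrix (f (radSq x' y'))) =
      fun x' y' => Matrix.of fun j k => spinMatrix (f' (radSq x' y')) j k * zc x' y' := by
    funext x' y'
    exact matDzbar_spinMatrix_radial (h _)
  rw [e]
  ext j k
  refine (dz_radial_mul_zc (hasDerivAt_spinMatrix h' j k)).trans ?_
  fin_cases j <;> fin_cases k <;> simp [spinMatrix] <;> ring

/-! ### The explicit map and gauge -/

/-- The map into the hyperboloid, as a function of `m = (a + b t) ^ (1 / 4)` and `ρ = z z̄`. -/
def blowupSpin (b ε m ρ : ℝ) : Fin 3 → ℝ :=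
  ![ε * ((m ^ 2 - (m ^ 2)⁻¹) / 2 + b ^ 2 * ρ ^ 2 / (8 * m ^ 6)),
    -(ε * b * ρ / (2 * m ^ 4)),
    -((m ^ 2 + (m ^ 2)⁻¹) / 2 + b ^ 2 * ρ ^ 2 / (8 * m ^ 6))]

/-- `exp (i b ρ / (4 m ^ 4))`, the square root of the phase of `q`. -/
def phase (b m ρ : ℝ) : ℂ := Complex.exp (Complex.I * (b * ρ / (4 * m ^ 4) : ℝ))

/-- The upper left entry of the gauge. -/
def gaugeP (b m ρ : ℝ) : ℂ :=
  (((m + m⁻¹) / 2 : ℝ) + Complex.I * (b * ρ / (4 * m ^ 3) : ℝ)) * (phase b m ρ)⁻¹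

/-- The upper right entry of the gauge. -/
def gaugeQ (b ε m ρ : ℝ) : ℂ :=
  -(Complex.I * ε) * (((m - m⁻¹) / 2 : ℝ) - Complex.I * (b * ρ / (4 * m ^ 3) : ℝ)) * phase b m ρ

/-- The fourth root of `a + b t`. -/
def fourthRoot (a b t : ℝ) : ℝ := √(√(a + b * t))

section fourthRoot

variable {a b t : ℝ}

lemma fourthRoot_pos (h : 0 < a + b * t) : 0 < fourthRoot a b t :=
  Real.sqrt_pos.2 (Real.sqrt_pos.2 h)

lemma fourthRoot_pow (h : 0 < a + b * t) : fourthRoot a b t ^ 4 = a + b * t := by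
  rw [fourthRoot, show 4 = 2 * 2 from rfl, pow_mul, Real.sq_sqrt (Real.sqrt_nonneg _),
    Real.sq_sqrt h.le]

lemma hasDerivAt_fourthRoot (h : 0 < a + b * t) :
    HasDerivAt (fourthRoot a b) (b / (4 * fourthRoot a b t ^ 3)) t := by
  have h1 : HasDerivAt (fun t => a + b * t) b t := by
    simpa using ((hasDerivAt_id t).const_mul b).const_add a
  refine ((h1.sqrt h.ne').sqrt (Real.sqrt_pos.2 h).ne').congr_deriv ?_
  have hm := fourthRoot_pos h
  have e : √(a + b * t) = fourthRoot a b t ^ 2 := by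
    rw [fourthRoot, Real.sq_sqrt (Real.sqrt_nonneg _)]
  change b / (2 * √(a + b * t)) / (2 * fourthRoot a b t) = _
  rw [e]
  field_simp
  norm_num

lemma contDiffOn_fourthRoot : ContDiffOn ℝ ∞ (fourthRoot a b) {t | 0 < a + b * t} := by
  unfold fourthRoot
  refine ContDiffOn.sqrt (ContDiffOn.sqrt (by fun_prop) fun t ht => ne_of_gt ht) fun t ht => ?_
  exact (Real.sqrt_pos.2 ht).ne'

end fourthRoot

/-! ### Algebraic and differential identities for the map and the gauge -/

section identities

variable {b ε m ρ : ℝ}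

lemma blowupSpin_mem (hε : ε ^ 2 = 1) (hm : 0 < m) :
    blowupSpin b ε m ρ ∈ hyperbolicPlane := by
  constructor
  · simp only [blowupSpin, Matrix.cons_val_zero, Matrix.cons_val_one, Matrix.cons_val]
    field_simp
    rw [hε]
    ring
  · simp only [blowupSpin, Matrix.cons_val, neg_lt_zero]
    positivity

lemma hasDerivAt_blowupSpin (b ε m ρ : ℝ) (j : Fin 3) :
    HasDerivAt (fun ρ' => blowupSpin b ε m ρ' j)
      ((![ε * (b ^ 2 * ρ / (4 * m ^ 6)), -(ε * b / (2 * m ^ 4)),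
        -(b ^ 2 * ρ / (4 * m ^ 6))] : Fin 3 → ℝ) j) ρ := by
  have h1 := ((hasDerivAt_id ρ).const_mul (ε * b)).div_const (2 * m ^ 4)
  have h2 := (((hasDerivAt_id ρ).fun_pow 2).const_mul (b ^ 2)).div_const (8 * m ^ 6)
  fin_cases j
  · refine ((h2.const_add ((m ^ 2 - (m ^ 2)⁻¹) / 2)).const_mul ε).congr_deriv ?_
    simp only [id, Fin.zero_eta, Matrix.cons_val_zero, Nat.cast_ofNat]
    ring
  · refine h1.fun_neg.congr_deriv ?_
    simp
  · refine ((h2.const_add ((m ^ 2 + (m ^ 2)⁻¹) / 2)).fun_neg).congr_deriv ?_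
    simp only [id, Fin.reduceFinMk, Matrix.cons_val, Nat.cast_ofNat]
    ring

lemma hasDerivAt_blowupSpin_deriv (b ε m ρ : ℝ) (j : Fin 3) :
    HasDerivAt (fun ρ' => (![ε * (b ^ 2 * ρ' / (4 * m ^ 6)), -(ε * b / (2 * m ^ 4)),
        -(b ^ 2 * ρ' / (4 * m ^ 6))] : Fin 3 → ℝ) j)
      ((![ε * (b ^ 2 / (4 * m ^ 6)), 0, -(b ^ 2 / (4 * m ^ 6))] : Fin 3 → ℝ) j) ρ := by
  have h1 := ((hasDerivAt_id ρ).const_mul (b ^ 2)).div_const (4 * m ^ 6)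
  rw [mul_one] at h1
  fin_cases j
  · exact h1.const_mul ε
  · exact hasDerivAt_const ρ _
  · exact h1.fun_neg

lemma hasDerivAt_blowupSpin_time {a t : ℝ} (ε ρ : ℝ) (h : 0 < a + b * t) (j : Fin 3) :
    HasDerivAt (fun t' => blowupSpin b ε (fourthRoot a b t') ρ j)
      ((![ε * (b / (4 * fourthRoot a b t ^ 2) + b / (4 * fourthRoot a b t ^ 6)
            - 3 * b ^ 3 * ρ ^ 2 / (16 * fourthRoot a b t ^ 10)),
          ε * b ^ 2 * ρ / (2 * fourthRoot a b t ^ 8),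
          -(b / (4 * fourthRoot a b t ^ 2) - b / (4 * fourthRoot a b t ^ 6)
            - 3 * b ^ 3 * ρ ^ 2 / (16 * fourthRoot a b t ^ 10))] : Fin 3 → ℝ) j) t := by
  have hm := fourthRoot_pos h
  have hd := hasDerivAt_fourthRoot h
  have h2 := hd.fun_pow 2
  have h2i := h2.fun_inv (pow_ne_zero 2 hm.ne')
  have h4 := (hasDerivAt_const t (ε * b * ρ)).fun_div ((hd.fun_pow 4).const_mul 2)
    (mul_ne_zero (by norm_num) (pow_ne_zero _ hm.ne'))
  have h6 := (hasDerivAt_const t (b ^ 2 * ρ ^ 2)).fun_div ((hd.fun_pow 6).const_mul 8)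
    (mul_ne_zero (by norm_num) (pow_ne_zero _ hm.ne'))
  fin_cases j
  · refine ((((h2.fun_sub h2i).div_const 2).fun_add h6).const_mul ε).congr_deriv ?_
    simp only [Fin.zero_eta, Matrix.cons_val_zero, Nat.cast_ofNat]
    field_simp
    ring
  · refine h4.fun_neg.congr_deriv ?_
    simp only [Fin.mk_one, Matrix.cons_val_one, Matrix.cons_val_zero, Nat.cast_ofNat]
    field_simp
    ring
  · refine ((((h2.fun_add h2i).div_const 2).fun_add h6).fun_neg).congr_deriv ?_
    simp only [Fin.reduceFinMk, Matrix.cons_val, Nat.cast_ofNat]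
    field_simp
    ring

/-- The left vector is the time derivative computed from m_t = b/(4m³), and the vector in the
commutator is ρf'' + f'. What remains is a rational identity in m, ρ, b modulo ε² = 1. -/
lemma schrodinger_identity (hε : ε ^ 2 = 1) (hm : m ≠ 0) :
    spinMatrix ![ε * (b / (4 * m ^ 2) + b / (4 * m ^ 6) - 3 * b ^ 3 * ρ ^ 2 / (16 * m ^ 10)),
        ε * b ^ 2 * ρ / (2 * m ^ 8),
        -(b / (4 * m ^ 2) - b / (4 * m ^ 6) - 3 * b ^ 3 * ρ ^ 2 / (16 * m ^ 10))] =
      -(1 / 2 : ℂ) •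
        (spinMatrix (blowupSpin b ε m ρ) *
            spinMatrix ![ε * (b ^ 2 * ρ / (2 * m ^ 6)), -(ε * b / (2 * m ^ 4)),
              -(b ^ 2 * ρ / (2 * m ^ 6))] -
          spinMatrix ![ε * (b ^ 2 * ρ / (2 * m ^ 6)), -(ε * b / (2 * m ^ 4)),
              -(b ^ 2 * ρ / (2 * m ^ 6))] *
            spinMatrix (blowupSpin b ε m ρ)) := by
  have hmc : (m : ℂ) ≠ 0 := by exact_mod_cast hm
  have hεc : (ε : ℂ) ^ 2 = 1 := by exact_mod_cast hε
  ext j k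
  fin_cases j <;> fin_cases k <;>
    simp [spinMatrix, blowupSpin] <;> field_simp <;>
    ring_nf <;> simp only [Complex.I_sq, hεc] <;> ring


lemma phase_ne_zero (b m ρ : ℝ) : phase b m ρ ≠ 0 := Complex.exp_ne_zero _

lemma star_phase (b m ρ : ℝ) : star (phase b m ρ) = (phase b m ρ)⁻¹ := by
  rw [phase, Complex.star_def, ← Complex.exp_conj, ← Complex.exp_neg, map_mul, Complex.conj_I,
    Complex.conj_ofReal, neg_mul]

lemma conj_phase (b m ρ : ℝ) : starRingEnd ℂ (phase b m ρ) = (phase b m ρ)⁻¹ :=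
  star_phase b m ρ

lemma norm_phase (b m ρ : ℝ) : ‖phase b m ρ‖ = 1 := by
  rw [phase, mul_comm, Complex.norm_exp_ofReal_mul_I]

lemma hasDerivAt_exp_I_mul {c : ℝ → ℝ} {c' x : ℝ} (h : HasDerivAt c c' x) :
    HasDerivAt (fun x' => Complex.exp (Complex.I * (c x' : ℝ)))
      (Complex.I * c' * Complex.exp (Complex.I * (c x : ℝ))) x := by
  refine (h.ofReal_comp.const_mul Complex.I).cexp.congr_deriv ?_
  ring

lemma hasDerivAt_phase (b m ρ : ℝ) :
    HasDerivAt (fun ρ' => phase b m ρ') (Complex.I * (b / (4 * m ^ 4) : ℝ) * phase b m ρ) ρ := by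
  have h := ((hasDerivAt_id ρ).const_mul b).div_const (4 * m ^ 4)
  rw [mul_one] at h
  exact hasDerivAt_exp_I_mul h

lemma hasDerivAt_phase_time {a t : ℝ} (ρ : ℝ) (h : 0 < a + b * t) :
    HasDerivAt (fun t' => phase b (fourthRoot a b t') ρ)
      (Complex.I * (-(b ^ 2 * ρ / (4 * fourthRoot a b t ^ 8)) : ℝ) *
        phase b (fourthRoot a b t) ρ) t := by
  have hm := fourthRoot_pos h
  have h4 := (hasDerivAt_const t (b * ρ)).fun_div
    (((hasDerivAt_fourthRoot h).fun_pow 4).const_mul 4)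
    (mul_ne_zero (by norm_num) (pow_ne_zero _ hm.ne'))
  refine hasDerivAt_exp_I_mul (h4.congr_deriv ?_)
  simp
  field_simp

/-- First row of the nilpotent system: the factor E⁻¹ contributes -iκ, which cancels the part of the
right side that would make A grow faster than linearly in ρ. -/
lemma hasDerivAt_gaugeP (hε : ε ^ 2 = 1) (hm : m ≠ 0) :
    HasDerivAt (fun ρ' => gaugeP b m ρ')
      (-(gaugeQ b ε m ρ * ((phase b m ρ)⁻¹ ^ 2 * (ε * b / (4 * m ^ 4) : ℝ)))) ρ := by
  have h := ((hasDerivAt_id ρ).const_mul b).div_const (4 * m ^ 3)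
  have hmc : (m : ℂ) ≠ 0 := by exact_mod_cast hm
  have hεc : (ε : ℂ) ^ 2 = 1 := by exact_mod_cast hε
  refine (((h.ofReal_comp.const_mul Complex.I).const_add (((m + m⁻¹) / 2 : ℝ) : ℂ)).fun_mul
    ((hasDerivAt_phase b m ρ).fun_inv (phase_ne_zero b m ρ))).congr_deriv ?_
  have hE := phase_ne_zero b m ρ
  rw [gaugeQ]
  generalize phase b m ρ = E at *
  push_cast
  simp only [id]
  field_simp
  rw [hεc]
  ring

lemma hasDerivAt_gaugeQ (hm : m ≠ 0) :
    HasDerivAt (fun ρ' => gaugeQ b ε m ρ')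
      (-(gaugeP b m ρ * (phase b m ρ ^ 2 * (ε * b / (4 * m ^ 4) : ℝ)))) ρ := by
  have h := ((hasDerivAt_id ρ).const_mul b).div_const (4 * m ^ 3)
  have hmc : (m : ℂ) ≠ 0 := by exact_mod_cast hm
  refine ((((h.ofReal_comp.const_mul Complex.I).const_sub (((m - m⁻¹) / 2 : ℝ) : ℂ)).const_mul
    (-(Complex.I * ε))).fun_mul (hasDerivAt_phase b m ρ)).congr_deriv ?_
  have hE := phase_ne_zero b m ρ
  rw [gaugeP]
  generalize phase b m ρ = E at *
  push_cast
  simp only [id]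
  field_simp
  ring_nf
  simp only [Complex.I_sq, Complex.I_pow_three]
  ring

lemma hasDerivAt_gaugeP_time {a t : ℝ} (ρ : ℝ) (hε : ε ^ 2 = 1) (h : 0 < a + b * t) :
    HasDerivAt (fun t' => gaugeP b (fourthRoot a b t') ρ)
      (gaugeP b (fourthRoot a b t) ρ *
          (Complex.I * (b ^ 2 * ρ / (8 * fourthRoot a b t ^ 8) : ℝ)) +
        gaugeQ b ε (fourthRoot a b t) ρ * (Complex.I *
          ((phase b (fourthRoot a b t) ρ)⁻¹ ^ 2 * (ε * b / (4 * fourthRoot a b t ^ 4) : ℝ) *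
            (1 - Complex.I * (b * ρ / (2 * fourthRoot a b t ^ 4) : ℝ))))) t := by
  have hm := fourthRoot_pos h
  have hd := hasDerivAt_fourthRoot h
  have h3 := (hasDerivAt_const t (b * ρ)).fun_div ((hd.fun_pow 3).const_mul 4)
    (mul_ne_zero (by norm_num) (pow_ne_zero _ hm.ne'))
  have hmc : (fourthRoot a b t : ℂ) ≠ 0 := by exact_mod_cast hm.ne'
  have hεc : (ε : ℂ) ^ 2 = 1 := by exact_mod_cast hε
  have hE := phase_ne_zero b (fourthRoot a b t) ρ
  refine ((((hd.fun_add (hd.fun_inv hm.ne')).div_const 2).ofReal_comp.fun_add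
    (h3.ofReal_comp.const_mul Complex.I)).fun_mul
    ((hasDerivAt_phase_time ρ h).fun_inv hE)).congr_deriv ?_
  rw [gaugeP, gaugeQ]
  generalize phase b (fourthRoot a b t) ρ = E at *
  generalize fourthRoot a b t = m at *
  push_cast
  field_simp
  rw [hεc]
  ring_nf
  simp only [Complex.I_sq, Complex.I_pow_three, Complex.I_pow_four]
  ring

lemma hasDerivAt_gaugeQ_time {a t : ℝ} (ε ρ : ℝ) (h : 0 < a + b * t) :
    HasDerivAt (fun t' => gaugeQ b ε (fourthRoot a b t') ρ)
      (-(gaugeP b (fourthRoot a b t) ρ * (Complex.I *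
          (phase b (fourthRoot a b t) ρ ^ 2 * (ε * b / (4 * fourthRoot a b t ^ 4) : ℝ) *
            (1 + Complex.I * (b * ρ / (2 * fourthRoot a b t ^ 4) : ℝ))))) -
        gaugeQ b ε (fourthRoot a b t) ρ *
          (Complex.I * (b ^ 2 * ρ / (8 * fourthRoot a b t ^ 8) : ℝ))) t := by
  have hm := fourthRoot_pos h
  have hd := hasDerivAt_fourthRoot h
  have h3 := (hasDerivAt_const t (b * ρ)).fun_div ((hd.fun_pow 3).const_mul 4)
    (mul_ne_zero (by norm_num) (pow_ne_zero _ hm.ne'))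
  have hmc : (fourthRoot a b t : ℂ) ≠ 0 := by exact_mod_cast hm.ne'
  have hE := phase_ne_zero b (fourthRoot a b t) ρ
  refine (((((hd.fun_sub (hd.fun_inv hm.ne')).div_const 2).ofReal_comp.fun_sub
    (h3.ofReal_comp.const_mul Complex.I)).const_mul (-(Complex.I * ε))).fun_mul
    (hasDerivAt_phase_time ρ h)).congr_deriv ?_
  rw [gaugeP, gaugeQ]
  generalize phase b (fourthRoot a b t) ρ = E at *
  generalize fourthRoot a b t = m at *
  push_cast
  field_simp
  ring

lemma star_gaugeP (b m ρ : ℝ) :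
    star (gaugeP b m ρ) =
      (((m + m⁻¹) / 2 : ℝ) - Complex.I * (b * ρ / (4 * m ^ 3) : ℝ)) * phase b m ρ := by
  rw [gaugeP, star_mul', star_inv₀, star_phase, inv_inv]
  simp only [Complex.star_def, map_add, map_mul, Complex.conj_ofReal, Complex.conj_I]
  ring

lemma star_gaugeQ (b ε m ρ : ℝ) :
    star (gaugeQ b ε m ρ) =
      Complex.I * ε * (((m - m⁻¹) / 2 : ℝ) + Complex.I * (b * ρ / (4 * m ^ 3) : ℝ)) *
        (phase b m ρ)⁻¹ := by
  rw [gaugeQ, star_mul', star_phase]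
  simp only [Complex.star_def, map_sub, map_neg, map_mul, Complex.conj_ofReal, Complex.conj_I]
  ring

/-- The phases have modulus one and the terms in ρ contribute equally to |P|² and |Q|², so the
difference is cosh² - sinh² at log m. -/
lemma gaugeP_mul_star_sub (hε : ε ^ 2 = 1) (hm : m ≠ 0) :
    gaugeP b m ρ * star (gaugeP b m ρ) - gaugeQ b ε m ρ * star (gaugeQ b ε m ρ) = 1 := by
  have hmc : (m : ℂ) ≠ 0 := by exact_mod_cast hm
  have hεc : (ε : ℂ) ^ 2 = 1 := by exact_mod_cast hε
  have hE := phase_ne_zero b m ρ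
  rw [star_gaugeP, star_gaugeQ, gaugeP, gaugeQ]
  push_cast
  field_simp
  rw [hεc]
  ring_nf
  simp only [Complex.I_sq, Complex.I_pow_four]
  ring

/-- The diagonal entry of Gσ₃G⁻¹; `gaugeP_mul_gaugeQ` supplies the off-diagonal one. -/
lemma gaugeP_mul_star_add (hε : ε ^ 2 = 1) (hm : m ≠ 0) :
    gaugeP b m ρ * star (gaugeP b m ρ) + gaugeQ b ε m ρ * star (gaugeQ b ε m ρ) =
      -(blowupSpin b ε m ρ 2 : ℂ) := by
  have hmc : (m : ℂ) ≠ 0 := by exact_mod_cast hm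
  have hεc : (ε : ℂ) ^ 2 = 1 := by exact_mod_cast hε
  have hE := phase_ne_zero b m ρ
  rw [star_gaugeP, star_gaugeQ, gaugeP, gaugeQ]
  simp only [blowupSpin, Matrix.cons_val]
  push_cast
  field_simp
  rw [hεc]
  ring_nf
  simp only [Complex.I_sq, Complex.I_pow_four]
  ring

lemma gaugeP_mul_gaugeQ (hm : m ≠ 0) :
    2 * Complex.I * gaugeP b m ρ * gaugeQ b ε m ρ =
      blowupSpin b ε m ρ 0 + Complex.I * blowupSpin b ε m ρ 1 := by
  have hmc : (m : ℂ) ≠ 0 := by exact_mod_cast hm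
  have hE := phase_ne_zero b m ρ
  rw [gaugeP, gaugeQ]
  simp only [blowupSpin, Matrix.cons_val_zero, Matrix.cons_val_one]
  push_cast
  field_simp
  ring_nf
  simp only [Complex.I_sq, Complex.I_pow_three, Complex.I_pow_four]
  ring

end identities

/-- The gauge as a matrix. -/
def gaugeMatrix (b ε m ρ : ℝ) : Matrix (Fin 2) (Fin 2) ℂ :=
  !![gaugeP b m ρ, gaugeQ b ε m ρ; star (gaugeQ b ε m ρ), star (gaugeP b m ρ)]

section gaugeMatrix

variable {b ε m ρ : ℝ}

lemma det_gaugeMatrix (hε : ε ^ 2 = 1) (hm : m ≠ 0) : (gaugeMatrix b ε m ρ).det = 1 := by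
  rw [gaugeMatrix, Matrix.det_fin_two_of, gaugeP_mul_star_sub hε hm]

lemma gaugeMatrix_mem (hε : ε ^ 2 = 1) (hm : m ≠ 0) : gaugeMatrix b ε m ρ ∈ SU11 := by
  refine ⟨?_, det_gaugeMatrix hε hm⟩
  have h := gaugeP_mul_star_sub (b := b) (ρ := ρ) hε hm
  ext j k
  fin_cases j <;> fin_cases k <;>
    simp [gaugeMatrix, sigma3, Matrix.mul_apply, Fin.sum_univ_two] <;>
    simp only [Complex.star_def] at h
  · linear_combination h
  · ring
  · ring
  · linear_combination -h

lemma spinMatrix_blowupSpin (hε : ε ^ 2 = 1) (hm : m ≠ 0) :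
    spinMatrix (blowupSpin b ε m ρ) =
      -(Complex.I • (gaugeMatrix b ε m ρ * sigma3 * (gaugeMatrix b ε m ρ)⁻¹)) := by
  have h1 := gaugeP_mul_star_add (b := b) (ρ := ρ) hε hm
  have h2 := gaugeP_mul_gaugeQ (b := b) (ε := ε) (ρ := ρ) hm
  have h3 := congrArg star h2
  simp only [star_add, star_mul', Complex.star_def, Complex.conj_ofReal, Complex.conj_I,
    map_ofNat] at h1 h3
  rw [Matrix.inv_def, det_gaugeMatrix hε hm, Ring.inverse_one, one_smul, gaugeMatrix,
    Matrix.adjugate_fin_two_of]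
  ext j k
  fin_cases j <;> fin_cases k <;>
    simp [spinMatrix, sigma3]
  · linear_combination Complex.I * h1
  · linear_combination -h2
  · linear_combination -h3
  · linear_combination h1

end gaugeMatrix

/-! ### The coefficients q, r, u in terms of m and ρ -/

section coefficients

variable {a b ε t x y : ℝ}

lemma qExplicit_eq (h : 0 < a + b * t) :
    qExplicit a b (ε * b / 4) t x y =
      phase b (fourthRoot a b t) (radSq x y) ^ 2 * (ε * b / (4 * fourthRoot a b t ^ 4) : ℝ) *
        star (zc x y) := by
  have hc : (a + b * t : ℂ) ≠ 0 := by exact_mod_cast h.ne'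
  rw [qExplicit, phase, fourthRoot_pow h, ← Complex.exp_nat_mul, mul_assoc (b : ℂ), zc_mul_star]
  push_cast
  -- `phase` carries half the exponent of q, so squaring restores it.
  rw [show (2 : ℂ) * (Complex.I * (b * radSq x y / (4 * (a + b * t)))) =
    Complex.I * (b * radSq x y / (2 * (a + b * t))) by
      field_simp
      ring]
  field_simp

lemma rExplicit_eq (h : 0 < a + b * t) :
    rExplicit a b (ε * b / 4) t x y =
      (phase b (fourthRoot a b t) (radSq x y))⁻¹ ^ 2 *
        (ε * b / (4 * fourthRoot a b t ^ 4) : ℝ) * star (zc x y) := by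
  have hc : (a + b * t : ℂ) ≠ 0 := by exact_mod_cast h.ne'
  rw [rExplicit, phase, fourthRoot_pow h, ← Complex.exp_neg, ← Complex.exp_nat_mul,
    mul_assoc (b : ℂ), zc_mul_star]
  push_cast
  rw [show (2 : ℂ) * -(Complex.I * (b * radSq x y / (4 * (a + b * t)))) =
    -(Complex.I * (b * radSq x y / (2 * (a + b * t)))) by
      field_simp
      ring]
  field_simp

lemma uExplicit_eq (hε : ε ^ 2 = 1) (h : 0 < a + b * t) :
    uExplicit a b (ε * b / 4) t x y =
      b ^ 2 * radSq x y / (8 * fourthRoot a b t ^ 8) := by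
  have hm := fourthRoot_pos h
  rw [uExplicit, norm_zc_sq, ← fourthRoot_pow h]
  field_simp
  rw [hε]
  ring

lemma dzbar_qExplicit (h : 0 < a + b * t) :
    dzbar (qExplicit a b (ε * b / 4) t) x y =
      phase b (fourthRoot a b t) (radSq x y) ^ 2 * (ε * b / (4 * fourthRoot a b t ^ 4) : ℝ) *
        (1 + Complex.I * (b * radSq x y / (2 * fourthRoot a b t ^ 4) : ℝ)) := by
  have hd := ((hasDerivAt_phase b (fourthRoot a b t) (radSq x y)).fun_pow 2).mul_const
    ((ε * b / (4 * fourthRoot a b t ^ 4) : ℝ) : ℂ)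
  -- The right side is left to unification: it is the form F(ρ) z̄ that `dzbar_radial_mul_star_zc`
  -- needs, valid on the whole plane at this fixed t.
  have e : qExplicit a b (ε * b / 4) t = _ := funext₂ fun x y => qExplicit_eq h
  rw [e, dzbar_radial_mul_star_zc hd]
  push_cast
  ring

lemma dzbar_rExplicit (h : 0 < a + b * t) :
    dzbar (rExplicit a b (ε * b / 4) t) x y =
      (phase b (fourthRoot a b t) (radSq x y))⁻¹ ^ 2 *
        (ε * b / (4 * fourthRoot a b t ^ 4) : ℝ) *
        (1 - Complex.I * (b * radSq x y / (2 * fourthRoot a b t ^ 4) : ℝ)) := by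
  have hE := phase_ne_zero b (fourthRoot a b t) (radSq x y)
  have hd := (((hasDerivAt_phase b (fourthRoot a b t) (radSq x y)).fun_inv hE).fun_pow 2).mul_const
    ((ε * b / (4 * fourthRoot a b t ^ 4) : ℝ) : ℂ)
  have e : rExplicit a b (ε * b / 4) t = _ := funext₂ fun x y => rExplicit_eq h
  rw [e, dzbar_radial_mul_star_zc hd]
  have hmc : (fourthRoot a b t : ℂ) ≠ 0 := by exact_mod_cast (fourthRoot_pos h).ne'
  push_cast
  field_simp
  ring

lemma norm_qExplicit_add_norm_rExplicit (hε : ε ^ 2 = 1) (h : 0 < a + b * t) :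
    ‖qExplicit a b (ε * b / 4) t x y‖ + ‖rExplicit a b (ε * b / 4) t x y‖ =
      |b| / (2 * (a + b * t)) * ‖zc x y‖ := by
  have hε' : |ε| = 1 := by rwa [← sq_eq_sq₀ (abs_nonneg ε) zero_le_one, sq_abs, one_pow]
  rw [qExplicit_eq h, rExplicit_eq h, fourthRoot_pow h]
  simp only [norm_mul, norm_pow, norm_inv, norm_phase, norm_star, Complex.norm_real,
    Real.norm_eq_abs, abs_div, abs_mul, hε', abs_of_pos h, Nat.abs_ofNat]
  field_simp
  ring

end coefficients

/-! ### Size and blow-up of the gradient -/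

section gradient

variable {a b ε t x y : ℝ}

/-- A single summand suffices: the z-derivative of the coordinate of index 1, which is linear in ρ.
-/
lemma le_gradSize_blowupSpin (hε : ε ^ 2 = 1) (h : 0 < a + b * t) :
    |b| / (2 * (a + b * t)) * ‖zc x y‖ ≤
      gradSize (fun x y => blowupSpin b ε (fourthRoot a b t) (radSq x y)) x y := by
  have hε' : |ε| = 1 := by rwa [← sq_eq_sq₀ (abs_nonneg ε) zero_le_one, sq_abs, one_pow]
  have hz : ‖dz (fun x' y' =>
      (blowupSpin b ε (fourthRoot a b t) (radSq x' y') 1 : ℂ)) x y‖ =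
      |b| / (2 * (a + b * t)) * ‖zc x y‖ := by
    rw [dz_radial (hasDerivAt_blowupSpin b ε (fourthRoot a b t) (radSq x y) 1).ofReal_comp,
      norm_mul, norm_star, Complex.norm_real]
    simp only [Matrix.cons_val_one, Matrix.cons_val_zero, Real.norm_eq_abs, abs_neg]
    rw [fourthRoot_pow h, abs_div, abs_mul, hε', one_mul, abs_of_pos (mul_pos two_pos h)]
  rw [← hz]
  refine (le_add_of_nonneg_right (norm_nonneg (dzbar (fun x' y' =>
    (blowupSpin b ε (fourthRoot a b t) (radSq x' y') 1 : ℂ)) x y))).trans ?_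
  exact Finset.single_le_sum (f := fun j : Fin 3 =>
    ‖dz (fun x' y' => (blowupSpin b ε (fourthRoot a b t) (radSq x' y') j : ℂ)) x y‖ +
    ‖dzbar (fun x' y' => (blowupSpin b ε (fourthRoot a b t) (radSq x' y') j : ℂ)) x y‖)
    (fun j _ => by positivity) (Finset.mem_univ 1)

lemma gradSize_blowupSpin_zero (b ε m : ℝ) :
    gradSize (fun x y => blowupSpin b ε m (radSq x y)) 0 0 = 0 := by
  have h0 : zc 0 0 = 0 := by simp [zc]
  refine Finset.sum_eq_zero fun j _ => ?_
  have h := (hasDerivAt_blowupSpin b ε m (radSq 0 0) j).ofReal_comp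
  rw [dz_radial h, dzbar_radial h, h0]
  simp

lemma zc_ne_zero (h : (x, y) ≠ (0, 0)) : zc x y ≠ 0 := by
  intro h0
  refine h ?_
  have e := norm_zc_sq x y
  rw [h0, norm_zero, radSq] at e
  have hx : x = 0 := by nlinarith [sq_nonneg x, sq_nonneg y]
  have hy : y = 0 := by nlinarith [sq_nonneg x, sq_nonneg y]
  rw [hx, hy]

end gradient

lemma add_mul_pos_of_lt {a b t : ℝ} (hb : b < 0) (ht : t < -a / b) : 0 < a + b * t := by
  rw [lt_div_iff_of_neg hb] at ht
  linarith

lemma tendsto_gradSize_blowupSpin_iff {a b ε : ℝ} (hb : b < 0) (hε : ε ^ 2 = 1) (x y : ℝ) :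
    Tendsto (fun t => gradSize
        (fun x y => blowupSpin b ε (fourthRoot a b t) (radSq x y)) x y)
      (𝓝[<] (-a / b)) atTop ↔ (x, y) ≠ (0, 0) := by
  constructor
  · rintro h h0
    obtain ⟨rfl, rfl⟩ := Prod.mk.inj h0
    simp only [gradSize_blowupSpin_zero] at h
    exact not_tendsto_const_atTop _ _ h
  · intro h
    -- Approach to 0 from above is needed for the reciprocal to tend to +∞; it holds because b < 0.
    have hlim : Tendsto (fun t => 2 * (a + b * t)) (𝓝[<] (-a / b)) (𝓝[>] 0) := by
      refine tendsto_nhdsWithin_iff.2 ⟨?_, ?_⟩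
      · have hc : Continuous fun t => 2 * (a + b * t) := by fun_prop
        have := (hc.tendsto (-a / b)).mono_left (nhdsWithin_le_nhds (s := Iio (-a / b)))
        rwa [mul_div_cancel₀ _ hb.ne, add_neg_cancel, mul_zero] at this
      · filter_upwards [self_mem_nhdsWithin] with t ht
        exact mul_pos two_pos (add_mul_pos_of_lt hb ht)
    have h1 := ((tendsto_inv_nhdsGT_zero.comp hlim).const_mul_atTop
      (abs_pos.2 hb.ne)).atTop_mul_const (norm_pos_iff.2 (zc_ne_zero h))
    refine tendsto_atTop_mono' _ ?_ h1
    filter_upwards [self_mem_nhdsWithin] with t ht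
    exact le_gradSize_blowupSpin hε (add_mul_pos_of_lt hb ht)

/-! ### Smoothness in time and space -/

section smoothness

variable {E : Type*} [NormedAddCommGroup E] [NormedSpace ℝ E] {U : Set E} {m ρ : E → ℝ} {b ε : ℝ}

lemma contDiffOn_ofReal {f : E → ℝ} (hf : ContDiffOn ℝ ∞ f U) :
    ContDiffOn ℝ ∞ (fun w => (f w : ℂ)) U :=
  Complex.ofRealCLM.contDiff.comp_contDiffOn hf

lemma contDiffOn_mul_div_pow (c d : ℝ) (n : ℕ) (hd : d ≠ 0) {f : E → ℝ}
    (hm : ContDiffOn ℝ ∞ m U) (hf : ContDiffOn ℝ ∞ f U) (h0 : ∀ w ∈ U, m w ≠ 0) :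
    ContDiffOn ℝ ∞ (fun w => c * f w / (d * m w ^ n)) U :=
  (contDiffOn_const.mul hf).div (contDiffOn_const.mul (hm.pow n))
    fun w hw => mul_ne_zero hd (pow_ne_zero _ (h0 w hw))

lemma contDiffOn_blowupSpin (hm : ContDiffOn ℝ ∞ m U) (hρ : ContDiffOn ℝ ∞ ρ U)
    (h0 : ∀ w ∈ U, m w ≠ 0) : ContDiffOn ℝ ∞ (fun w => blowupSpin b ε (m w) (ρ w)) U := by
  have hm2 := hm.pow 2
  have hi := hm2.inv fun w hw => pow_ne_zero 2 (h0 w hw)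
  have h6 := contDiffOn_mul_div_pow (b ^ 2) 8 6 (by norm_num) hm (hρ.pow 2) h0
  have h4 := contDiffOn_mul_div_pow (ε * b) 2 4 (by norm_num) hm hρ h0
  refine contDiffOn_pi.2 fun j => ?_
  fin_cases j
  · exact contDiffOn_const.mul (((hm2.sub hi).div_const 2).add h6)
  · exact h4.neg
  · exact (((hm2.add hi).div_const 2).add h6).neg

lemma contDiffOn_phase (hm : ContDiffOn ℝ ∞ m U) (hρ : ContDiffOn ℝ ∞ ρ U)
    (h0 : ∀ w ∈ U, m w ≠ 0) : ContDiffOn ℝ ∞ (fun w => phase b (m w) (ρ w)) U :=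
  (contDiffOn_const.mul
    (contDiffOn_ofReal (contDiffOn_mul_div_pow b 4 4 (by norm_num) hm hρ h0))).cexp

lemma contDiffOn_gaugeP (hm : ContDiffOn ℝ ∞ m U) (hρ : ContDiffOn ℝ ∞ ρ U)
    (h0 : ∀ w ∈ U, m w ≠ 0) : ContDiffOn ℝ ∞ (fun w => gaugeP b (m w) (ρ w)) U :=
  ((contDiffOn_ofReal ((hm.add (hm.inv h0)).div_const 2)).add (contDiffOn_const.mul
    (contDiffOn_ofReal (contDiffOn_mul_div_pow b 4 3 (by norm_num) hm hρ h0)))).mul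
    ((contDiffOn_phase hm hρ h0).inv fun _ _ => phase_ne_zero _ _ _)

lemma contDiffOn_gaugeQ (hm : ContDiffOn ℝ ∞ m U) (hρ : ContDiffOn ℝ ∞ ρ U)
    (h0 : ∀ w ∈ U, m w ≠ 0) : ContDiffOn ℝ ∞ (fun w => gaugeQ b ε (m w) (ρ w)) U :=
  (contDiffOn_const.mul ((contDiffOn_ofReal ((hm.sub (hm.inv h0)).div_const 2)).sub
    (contDiffOn_const.mul
      (contDiffOn_ofReal (contDiffOn_mul_div_pow b 4 3 (by norm_num) hm hρ h0))))).mul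
    (contDiffOn_phase hm hρ h0)

lemma contDiffOn_gaugeMatrix (hm : ContDiffOn ℝ ∞ m U) (hρ : ContDiffOn ℝ ∞ ρ U)
    (h0 : ∀ w ∈ U, m w ≠ 0) (j k : Fin 2) :
    ContDiffOn ℝ ∞ (fun w => gaugeMatrix b ε (m w) (ρ w) j k) U := by
  have hs : ContDiff ℝ ∞ (fun w : ℂ => star w) := Complex.conjCLE.contDiff
  fin_cases j <;> fin_cases k
  · exact contDiffOn_gaugeP hm hρ h0
  · exact contDiffOn_gaugeQ hm hρ h0
  · exact hs.comp_contDiffOn (contDiffOn_gaugeQ hm hρ h0)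
  · exact hs.comp_contDiffOn (contDiffOn_gaugeP hm hρ h0)

end smoothness

lemma contDiffOn_fourthRoot_fst {a b : ℝ} (hb : b < 0) :
    ContDiffOn ℝ ∞ (fun w : ℝ × ℝ × ℝ => fourthRoot a b w.1) (Iio (-a / b) ×ˢ univ) :=
  contDiffOn_fourthRoot.comp contDiffOn_fst fun _ hw => add_mul_pos_of_lt hb hw.1

lemma contDiff_radSq : ContDiff ℝ ∞ (fun w : ℝ × ℝ × ℝ => radSq w.2.1 w.2.2) := by
  unfold radSq
  fun_prop

/-! ### Verification of the two systems -/

lemma isSmoothSchrodingerMap_blowupSpin {a b ε : ℝ} (hb : b < 0) (hε : ε ^ 2 = 1) :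
    IsSmoothSchrodingerMap (Iio (-a / b))
      (fun t x y => blowupSpin b ε (fourthRoot a b t) (radSq x y)) where
  smooth := contDiffOn_blowupSpin (contDiffOn_fourthRoot_fst hb) contDiff_radSq.contDiffOn
    fun w hw => (fourthRoot_pos (add_mul_pos_of_lt hb hw.1)).ne'
  mem t ht x y := blowupSpin_mem hε (fourthRoot_pos (add_mul_pos_of_lt hb ht))
  eqn t ht x y := by
    have h := add_mul_pos_of_lt hb ht
    have hm := fourthRoot_pos h
    have hL := matDz_matDzbar_spinMatrix_radial (x := x) (y := y)
      (hasDerivAt_blowupSpin b ε (fourthRoot a b t))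
      (hasDerivAt_blowupSpin_deriv b ε (fourthRoot a b t) (radSq x y))
    -- In ρf'' + f' the entries of f' linear in ρ double, while the constant one is unchanged.
    have hw : (fun j => radSq x y * (![ε * (b ^ 2 / (4 * fourthRoot a b t ^ 6)), 0,
          -(b ^ 2 / (4 * fourthRoot a b t ^ 6))] : Fin 3 → ℝ) j +
        (![ε * (b ^ 2 * radSq x y / (4 * fourthRoot a b t ^ 6)),
          -(ε * b / (2 * fourthRoot a b t ^ 4)),
          -(b ^ 2 * radSq x y / (4 * fourthRoot a b t ^ 6))] : Fin 3 → ℝ) j) =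
        ![ε * (b ^ 2 * radSq x y / (2 * fourthRoot a b t ^ 6)),
          -(ε * b / (2 * fourthRoot a b t ^ 4)),
          -(b ^ 2 * radSq x y / (2 * fourthRoot a b t ^ 6))] := by
      ext j
      fin_cases j <;> simp <;> ring
    rw [hw] at hL
    rw [hL, ← schrodinger_identity hε hm.ne']
    ext j k
    exact (hasDerivAt_spinMatrix (hasDerivAt_blowupSpin_time ε (radSq x y) h) j k).deriv

lemma isGaugeTransform_gaugeMatrix {a b ε : ℝ} (hb : b < 0) (hε : ε ^ 2 = 1) :
    IsGaugeTransform (Iio (-a / b)) (fun _ _ _ => 0) (qExplicit a b (ε * b / 4))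
      (rExplicit a b (ε * b / 4)) (uExplicit a b (ε * b / 4))
      (fun t x y => gaugeMatrix b ε (fourthRoot a b t) (radSq x y))
      (fun t x y => blowupSpin b ε (fourthRoot a b t) (radSq x y)) where
  smooth j k := contDiffOn_gaugeMatrix (contDiffOn_fourthRoot_fst hb) contDiff_radSq.contDiffOn
    (fun w hw => (fourthRoot_pos (add_mul_pos_of_lt hb hw.1)).ne') j k
  mem t ht x y := gaugeMatrix_mem hε (fourthRoot_pos (add_mul_pos_of_lt hb ht)).ne'
  eqn_z t ht x y := by
    have h := add_mul_pos_of_lt hb ht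
    have hm := (fourthRoot_pos h).ne'
    have hP := hasDerivAt_gaugeP (b := b) (ρ := radSq x y) hε hm
    have hQ := hasDerivAt_gaugeQ (b := b) (ε := ε) (ρ := radSq x y) hm
    rw [qExplicit_eq h, rExplicit_eq h]
    ext j k
    fin_cases j <;> fin_cases k
    · refine (dz_radial hP).trans ?_
      simp [gaugeMatrix]
      ring
    · refine (dz_radial hQ).trans ?_
      simp [gaugeMatrix]
      ring
    · refine (dz_star (fun x' y' => gaugeQ b ε (fourthRoot a b t) (radSq x' y')) x y).trans ?_
      rw [dzbar_radial hQ]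
      simp [gaugeMatrix, conj_phase]
      ring
    · refine (dz_star (fun x' y' => gaugeP b (fourthRoot a b t) (radSq x' y')) x y).trans ?_
      rw [dzbar_radial hP]
      simp [gaugeMatrix, conj_phase]
      ring
  eqn_zbar t ht x y := by
    have h := add_mul_pos_of_lt hb ht
    have hm := (fourthRoot_pos h).ne'
    have hP := hasDerivAt_gaugeP (b := b) (ρ := radSq x y) hε hm
    have hQ := hasDerivAt_gaugeQ (b := b) (ε := ε) (ρ := radSq x y) hm
    rw [qExplicit_eq h, rExplicit_eq h]
    ext j k
    fin_cases j <;> fin_cases k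
    · refine (dzbar_radial hP).trans ?_
      simp [gaugeMatrix, conj_phase]
      ring
    · refine (dzbar_radial hQ).trans ?_
      simp [gaugeMatrix, conj_phase]
      ring
    · refine (dzbar_star (fun x' y' => gaugeQ b ε (fourthRoot a b t) (radSq x' y')) x y).trans ?_
      rw [dz_radial hQ]
      simp [gaugeMatrix, conj_phase]
      ring
    · refine (dzbar_star (fun x' y' => gaugeP b (fourthRoot a b t) (radSq x' y')) x y).trans ?_
      rw [dz_radial hP]
      simp [gaugeMatrix, conj_phase]
      ring
  eqn_t t ht x y := by
    have h := add_mul_pos_of_lt hb ht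
    have hP := hasDerivAt_gaugeP_time (radSq x y) hε h
    have hQ := hasDerivAt_gaugeQ_time ε (radSq x y) h
    rw [dzbar_qExplicit h, dzbar_rExplicit h, uExplicit_eq hε h]
    ext j k
    fin_cases j <;> fin_cases k
    · refine hP.deriv.trans ?_
      simp [gaugeMatrix]
    · refine hQ.deriv.trans ?_
      simp [gaugeMatrix]
      ring
    -- The second row follows by conjugation, since r_z̄ is the conjugate of q_z̄ and u is real.
    · refine hQ.star.deriv.trans ?_
      simp [gaugeMatrix, conj_phase]
      ring
    · refine hP.star.deriv.trans ?_
      simp [gaugeMatrix, conj_phase]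
      ring
  spin_eq t ht x y := spinMatrix_blowupSpin hε (fourthRoot_pos (add_mul_pos_of_lt hb ht)).ne'

end

theorem theorem4 (a b α : ℝ) (ha : 0 < a) (hb : b < 0) (hα : α ^ 2 = b ^ 2 / 16) :
    ∃ (s : ℝ → ℝ → ℝ → Fin 3 → ℝ) (G : ℝ → ℝ → ℝ → Matrix (Fin 2) (Fin 2) ℂ),
      IsSmoothSchrodingerMap (Iio (-a / b)) s ∧
      (∀ x y : ℝ,
        Tendsto (fun t => gradSize (s t) x y) (𝓝[<] (-a / b)) atTop ↔ (x, y) ≠ (0, 0)) ∧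
      IsGaugeTransform (Iio (-a / b)) (fun _ _ _ => 0) (qExplicit a b α) (rExplicit a b α)
        (uExplicit a b α) G s ∧
      ∀ t ∈ Iio (-a / b), ∀ x y : ℝ,
        ‖qExplicit a b α t x y‖ + ‖rExplicit a b α t x y‖ ≤ gradSize (s t) x y := by
  have hε₀ : (4 * α / b) ^ 2 = 1 := by
    rw [div_pow, mul_pow, hα]
    field_simp [hb.ne]
    norm_num
  -- The two roots α = ±b/4 are treated at once through the sign ε.
  obtain ⟨ε, hε, rfl⟩ : ∃ ε : ℝ, ε ^ 2 = 1 ∧ α = ε * b / 4 :=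
    ⟨4 * α / b, hε₀, by field_simp [hb.ne]⟩
  refine ⟨_, _, isSmoothSchrodingerMap_blowupSpin hb hε,
    tendsto_gradSize_blowupSpin_iff hb hε, isGaugeTransform_gaugeMatrix hb hε,
    fun t ht x y => ?_⟩
  have h := add_mul_pos_of_lt hb ht
  rw [norm_qExplicit_add_norm_rExplicit hε h]
  exact le_gradSize_blowupSpin hε h
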